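/- Let $\{X_n, n\ge 1\}$ be a sequence of integrable random variables with $\mathbb{E}X_n=0$ on a probability space. For $a>0$ let $X_i^{(a)}=-a\mathbf 1(X_i<-a)+X_i\mathbf 1(|X_i|\le a)+a\mathbf 1(X_i>a)$. Assume that the sequence satisfies condition (H): there is a constant $C$ such that for all $a>0$, $m\ge 0$ and $n\ge 1$, $$\mathbb{E}\Big[\Big(\max_{1\le k\le n}\Big|\sum_{i=m+1}^{m+k}\big(X_i^{(a)}-\mathbb{E}X_i^{(a)}\big)\Big|\Big)^2\Big]\le C\sum_{i=m+1}^{m+n}\mathbb{E}\big[(X_i^{(a)})^2\big].$$ Let $1\le p<2$ and let $L$ be slowly varying at infinity, that is, $L$ is positive and measurable on $[A,\infty)$ for some $A\ge0$, and $L(\lambda x)/L(x)\to1$ as $x\to\infty$ for every $\lambda>0$. When $p=1$, assume further that $L$ is nondecreasing on $[0,\infty)$ and $L(x)\ge1$ for all $x\ge0$. Let $\tilde L$ be the de Bruijn conjugate of $L$, that is, a slowly varying function (unique up to asymptotic equivalence) with $$\lim_{x\to\infty}L(x)\tilde L(xL(x))=1\quad\text{and}\quad\lim_{x\to\infty}\tilde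 L(x)L(x\tilde L(x))=1.$$ If $$\int_0^\infty x^{p-1}L^p(x)\Big(\sup_{n\ge1}\frac1n\sum_{i=1}^n\mathbb{P}(|X_i|>x)\Big)\,dx<\infty,$$ then $$\lim_{n\to\infty}\frac{\sum_{i=1}^nX_i}{n^{1/p}\,\tilde L(n^{1/p})}=0\quad\text{almost surely.}$$ -/

import Mathlib

open MeasureTheory Filter Topology

noncomputable section

namespace MZLaw

/-- `L` is slowly varying (at infinity): it is positive and measurable on some `[A, ∞)` with
`A ≥ 0`, and `L (c x) / L x → 1` as `x → ∞` for every `c > 0`. -/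
def SlowlyVarying (L : ℝ → ℝ) : Prop :=
  (∃ A : ℝ, 0 ≤ A ∧ (∀ x ∈ Set.Ici A, 0 < L x) ∧ Measurable ((Set.Ici A).domRestrict L)) ∧
    ∀ c : ℝ, 0 < c → Tendsto (fun x => L (c * x) / L x) atTop (𝓝 1)

/-- `M` is a de Bruijn conjugate of `L`: a slowly varying function with
`L x * M (x L x) → 1` and `M x * L (x M x) → 1` as `x → ∞`. It is unique up to asymptotic
equivalence. -/
def IsDeBruijnConjugate (L M : ℝ → ℝ) : Prop :=
  SlowlyVarying M ∧
    Tendsto (fun x => L x * M (x * L x)) atTop (𝓝 1) ∧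
    Tendsto (fun x => M x * L (x * M x)) atTop (𝓝 1)

/-- Truncation at level `a`: `-a 1(y < -a) + y 1(|y| ≤ a) + a 1(y > a)`. -/
def trunc (a y : ℝ) : ℝ :=
  (if y < -a then -a else 0) + (if |y| ≤ a then y else 0) + (if a < y then a else 0)

variable {Ω : Type*} [MeasurableSpace Ω]

/-- The finite collection `X 1, …, X N` satisfies condition (H) with constant `C`: for all `a > 0`,
the maximal inequality of second order holds for the truncations at level `a` of all blocks
`X (m+1), …, X (m+n)`. -/
def FiniteConditionH (μ : Measure Ω) (X : ℕ → Ω → ℝ) (C : ℝ) (N : ℕ) : Prop :=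
  ∀ a : ℝ, 0 < a → ∀ m n : ℕ, ∀ hn : 1 ≤ n, m + n ≤ N →
    ∫ ω, ((Finset.Icc 1 n).sup' (Finset.nonempty_Icc.mpr hn) (fun k =>
        |∑ i ∈ Finset.Icc (m + 1) (m + k),
          (trunc a (X i ω) - ∫ ω', trunc a (X i ω') ∂μ)|)) ^ 2 ∂μ
      ≤ C * ∑ i ∈ Finset.Icc (m + 1) (m + n), ∫ ω, (trunc a (X i ω)) ^ 2 ∂μ

/-- The sequence `X 1, X 2, …` satisfies condition (H): its finite segments `X 1, …, X N` satisfy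
condition (H), with a constant that depends neither on `N` nor on the truncation level. -/
def ConditionH (μ : Measure Ω) (X : ℕ → Ω → ℝ) : Prop :=
  ∃ C : ℝ, ∀ N : ℕ, FiniteConditionH μ X C N

/-- `G x = sup_{n ≥ 1} (1/n) ∑_{i=1}^n P(|X i| > x)`. -/
def cesaroTail (μ : Measure Ω) (X : ℕ → Ω → ℝ) (x : ℝ) : ℝ :=
  ⨆ n : ℕ+, (1 / (n : ℝ)) * ∑ i ∈ Finset.Icc 1 (n : ℕ), μ.real {ω | x < |X i ω|}

end MZLaw

end

noncomputable section

namespace MZLaw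

/-! Write `G` for `cesaroTail` and `b k = norming p M (2 ^ k)`, and truncate the variables of the
dyadic block `2 ^ k ≤ i < 2 ^ (k + 1)` at `b k`. Conjugacy makes `2 ^ k` comparable to `(b k * L (b
k)) ^ p`, so the integral hypothesis becomes `∑ 2 ^ k * G (b k) < ∞`. This series and the growth of
`b` (`IsBlockNorming`, obtained in `exists_isBlockNorming`) drive three estimates.

By Borel–Cantelli, truncation eventually changes nothing (`ae_eventually_abs_le`). As `p < 2`, `b`
grows faster than `√2 ^ k`, so condition (H) makes the second moments of the normed block maxima
summable (`ae_tendsto_blockMax_div`). As `b k / 2 ^ k` is almost decreasing, the truncated means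
over a block add up to at most `b k` times a tail of the series (`sum_block_abs_integral_trunc_le`).
Hence each block contributes `o(b k)`, and geometric growth carries this to all partial sums
(`tendsto_sum_div_of_block`). -/

/-! ### Slow variation, uniformly on compact sets of ratios -/

/-- Karamata's uniform convergence theorem, in additive form. -/
lemma eventually_abs_sub_lt_of_tendsto_add {h : ℝ → ℝ} (hm : Measurable h)
    (hlim : ∀ u, Tendsto (fun s => h (s + u) - h s) atTop (𝓝 0)) {T ε : ℝ} (hT : 0 < T)
    (hε : 0 < ε) : ∀ᶠ s in atTop, ∀ u ∈ Set.Icc 0 T, |h (s + u) - h s| < ε := by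
  by_contra hcon
  obtain ⟨x, hx, hxu⟩ := exists_seq_forall_of_frequently (not_eventually.mp hcon)
  push Not at hxu
  choose u hu hux using hxu
  -- Continuity of measure: along any sequence tending to infinity, the shifts that are good from
  -- some index on fill more than three quarters of `[0, 2T]`.
  have key : ∀ z : ℕ → ℝ, Tendsto z atTop atTop →
      ∃ N : ℕ, ∀ n ≥ N, ENNReal.ofReal (3 / 2 * T) < volume
        {v ∈ Set.Icc 0 (2 * T) | ∀ m ≥ n, |h (z m + v) - h (z m)| < ε / 2} := by
    intro z hz
    let V : ℕ → Set ℝ := fun n => {v ∈ Set.Icc 0 (2 * T) | ∀ m ≥ n, |h (z m + v) - h (z m)| < ε / 2}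
    have hmono : Monotone V := fun i j hij v hv => ⟨hv.1, fun m hm => hv.2 m (hij.trans hm)⟩
    have hU : ⋃ n, V n = Set.Icc 0 (2 * T) := by
      refine Set.Subset.antisymm (Set.iUnion_subset fun n v hv => hv.1) fun v hv => ?_
      have := ((hlim v).comp hz).eventually (Metric.ball_mem_nhds 0 (half_pos hε))
      obtain ⟨n, hn⟩ := eventually_atTop.mp this
      refine Set.mem_iUnion.mpr ⟨n, hv, fun m hm => ?_⟩
      simpa [Real.dist_eq] using hn m hm
    have ht := tendsto_measure_iUnion_atTop (μ := volume) hmono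
    rw [hU, Real.volume_Icc] at ht
    exact eventually_atTop.mp (ht.eventually (lt_mem_nhds
      ((ENNReal.ofReal_lt_ofReal_iff (by linarith)).mpr (by linarith))))
  obtain ⟨N₁, h₁⟩ := key x hx
  obtain ⟨N₂, h₂⟩ := key (fun n => x n + u n)
    (tendsto_atTop_mono (fun n => by linarith [(hu n).1]) hx)
  let n := max N₁ N₂
  specialize h₁ n (le_max_left _ _)
  specialize h₂ n (le_max_right _ _)
  set V := {v ∈ Set.Icc 0 (2 * T) | ∀ m ≥ n, |h (x m + v) - h (x m)| < ε / 2}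
  set W := {v ∈ Set.Icc 0 (2 * T) | ∀ m ≥ n, |h (x m + u m + v) - h (x m + u m)| < ε / 2} with hW
  have hWm : MeasurableSet W := by
    have : W = Set.Icc 0 (2 * T) ∩
        ⋂ m, ⋂ (_ : m ≥ n), {v | |h (x m + u m + v) - h (x m + u m)| < ε / 2} := by
      ext v; simp [hW]
    rw [this]
    refine measurableSet_Icc.inter (.iInter fun m => .iInter fun _ => ?_)
    exact measurableSet_lt (by fun_prop) measurable_const
  set W' := (fun v => v + -u n) ⁻¹' W
  have hvol : volume W' = volume W := measure_preimage_add_right volume _ _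
  -- A common point would link `h (x n)` to `h (x n + u n)` by two steps shorter than `ε / 2`. So
  -- two disjoint sets of measure above `3T / 2` would lie in `[0, 3T]`.
  have hdisj : Disjoint V W' := by
    rw [Set.disjoint_left]
    intro v hv hw
    have e1 := hv.2 n le_rfl
    have e2 := hw.2 n le_rfl
    have e3 := hux n
    rw [show x n + u n + (v + -u n) = x n + v by ring] at e2
    rw [abs_lt] at e1 e2
    rcases le_abs.mp e3 with e3 | e3 <;> linarith [e1.1, e1.2, e2.1, e2.2]
  have hsub : V ∪ W' ⊆ Set.Icc 0 (3 * T) := by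
    rintro v (hv | hv)
    · exact ⟨hv.1.1, hv.1.2.trans (by linarith)⟩
    · have := hv.1
      have h3 := hu n
      simp only [Set.mem_Icc] at this h3 ⊢
      constructor <;> linarith [this.1, this.2, h3.1, h3.2]
  have hle := measure_mono (μ := volume) hsub
  rw [measure_union hdisj (hWm.preimage (by fun_prop)), hvol, Real.volume_Icc] at hle
  have := (ENNReal.add_lt_add h₁ h₂).trans_le hle
  rw [← ENNReal.ofReal_add (by linarith) (by linarith)] at this
  have := (ENNReal.ofReal_lt_ofReal_iff (by linarith)).mp this
  linarith

lemma SlowlyVarying.eventually_pos {L : ℝ → ℝ} (hL : SlowlyVarying L) :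
    ∀ᶠ x in atTop, 0 < L x := by
  obtain ⟨⟨A, -, hpos, -⟩, -⟩ := hL
  filter_upwards [eventually_ge_atTop A] with x hx using hpos x hx

lemma SlowlyVarying.eventually_bounds {L : ℝ → ℝ} (hL : SlowlyVarying L) :
    ∀ᶠ x in atTop, ∀ c ∈ Set.Icc (1 : ℝ) 4, L x ≤ 2 * L (c * x) ∧ L (c * x) ≤ 2 * L x := by
  have hpos' := hL.eventually_pos
  obtain ⟨⟨A, hA, hpos, hmeas⟩, hlim⟩ := hL
  -- `L` is arbitrary below `A`; cutting it off there gives a globally measurable function with the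
  -- same behaviour at infinity.
  have hm : Measurable ((Set.Ici A).indicator L) := by
    refine measurable_of_restrict_of_restrict_compl (s := Set.Ici A) measurableSet_Ici ?_ ?_
    · convert hmeas using 1
      ext x
      simp [Set.domRestrict]
    · convert measurable_const (a := (0 : ℝ)) using 1
      ext ⟨x, hx⟩
      simp only [Set.domRestrict_apply]
      exact Set.indicator_of_notMem hx _
  let h : ℝ → ℝ := fun s => Real.log ((Set.Ici A).indicator L (Real.exp s))
  have hh : Measurable h := Real.measurable_log.comp (hm.comp Real.measurable_exp)
  have hind : ∀ᶠ s in atTop, 0 < L (Real.exp s) ∧ h s = Real.log (L (Real.exp s)) := by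
    filter_upwards [Real.tendsto_exp_atTop.eventually (eventually_ge_atTop A)] with s hs
    exact ⟨hpos _ hs, by simp only [h]; rw [Set.indicator_of_mem (show _ ∈ Set.Ici A from hs)]⟩
  have hlim' : ∀ u, Tendsto (fun s => h (s + u) - h s) atTop (𝓝 0) := by
    intro u
    have h1 := ((hlim (Real.exp u) (Real.exp_pos u)).comp Real.tendsto_exp_atTop).log one_ne_zero
    rw [Real.log_one] at h1
    refine h1.congr' ?_
    filter_upwards [hind, (tendsto_atTop_add_const_right atTop u tendsto_id).eventually hind]
      with s hs hs'
    simp only [id] at hs'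
    simp only [Function.comp]
    rw [hs.2, hs'.2, add_comm s u, Real.exp_add, Real.log_div _ hs.1.ne']
    rw [← Real.exp_add, add_comm]
    exact hs'.1.ne'
  have hev := eventually_abs_sub_lt_of_tendsto_add hh hlim' (T := Real.log 4) (ε := Real.log 2)
    (Real.log_pos (by norm_num)) (Real.log_pos (by norm_num))
  filter_upwards [Real.tendsto_log_atTop.eventually hev, Real.tendsto_log_atTop.eventually
    (eventually_forall_ge_atTop.mpr hind), eventually_gt_atTop 0] with x hx hx2 hx0 c hc
  have hc0 : 0 < c := by linarith [hc.1]
  have hlc : 0 ≤ Real.log c := Real.log_nonneg hc.1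
  have h1 := hx (Real.log c) ⟨hlc, Real.log_le_log hc0 hc.2⟩
  obtain ⟨p1, e1⟩ := hx2 (Real.log x) le_rfl
  obtain ⟨p2, e2⟩ := hx2 (Real.log x + Real.log c) (by linarith)
  rw [e1, e2] at h1
  rw [Real.exp_add, Real.exp_log hx0, Real.exp_log hc0, mul_comm] at h1 p2
  rw [Real.exp_log hx0] at p1
  rw [abs_lt] at h1
  constructor
  · rw [← Real.log_le_log_iff p1 (by positivity), Real.log_mul two_ne_zero p2.ne']
    linarith [h1.1]
  · rw [← Real.log_le_log_iff p2 (by positivity), Real.log_mul two_ne_zero p1.ne']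
    linarith [h1.2]

/-! ### Contractive recursions for real sequences -/

lemma summable_of_succ_le_mul_add {v e : ℕ → ℝ} {r : ℝ} (hr : r < 1) (hv : ∀ k, 0 ≤ v k)
    (he0 : ∀ k, 0 ≤ e k) (he : Summable e) (h : ∀ k, v (k + 1) ≤ r * v k + e k) : Summable v := by
  rcases lt_or_ge r 0 with hr0 | hr0
  · rw [← summable_nat_add_iff 1]
    exact he.of_nonneg_of_le (fun k => hv _)
      fun k => (h k).trans (by nlinarith [hv k])
  refine summable_of_sum_range_le (c := (v 0 + ∑' k, e k) / (1 - r)) hv fun n => ?_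
  rw [le_div_iff₀ (by linarith)]
  have h1 : ∑ k ∈ Finset.range (n + 1), v k
      ≤ v 0 + (r * ∑ k ∈ Finset.range n, v k + ∑ k ∈ Finset.range n, e k) := by
    rw [Finset.sum_range_succ', add_comm, Finset.mul_sum, ← Finset.sum_add_distrib]
    gcongr with k
    exact h k
  rw [Finset.sum_range_succ] at h1
  have := he.sum_le_tsum (Finset.range n) (fun k _ => he0 k)
  linarith [hv n]

lemma tendsto_zero_of_succ_le_mul_add {t e : ℕ → ℝ} {r : ℝ} (hr0 : 0 ≤ r) (hr : r < 1)
    (ht : ∀ k, 0 ≤ t k) (he : Tendsto e atTop (𝓝 0))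
    (h : ∀ᶠ k in atTop, t (k + 1) ≤ r * t k + e k) :
    Tendsto t atTop (𝓝 0) := by
  refine tendsto_order.mpr ⟨fun a ha => .of_forall fun k => ha.trans_le (ht k), fun ε hε => ?_⟩
  obtain ⟨N, hN⟩ := eventually_atTop.mp
    -- With errors below this threshold, `ε / 2` is a supersolution of the recursion.
    (h.and (he.eventually (gt_mem_nhds (show 0 < ε / 2 * (1 - r) by nlinarith))))
  have hind : ∀ k, t (N + k) ≤ r ^ k * t N + ε / 2 := by
    intro k
    induction k with
    | zero => simp; linarith
    | succ k ih =>
      obtain ⟨h1, h2⟩ := hN (N + k) (by omega)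
      have := mul_le_mul_of_nonneg_left ih hr0
      rw [← add_assoc, pow_succ]
      nlinarith
  have hp : Tendsto (fun k => r ^ k * t N) atTop (𝓝 0) := by
    simpa using (tendsto_pow_atTop_nhds_zero_of_lt_one hr0 hr).mul_const (t N)
  obtain ⟨K, hK⟩ := eventually_atTop.mp (hp.eventually (gt_mem_nhds (half_pos hε)))
  refine eventually_atTop.mpr ⟨N + K, fun k hk => ?_⟩
  have h1 := hind (k - N)
  have h2 := hK (k - N) (by omega)
  rw [show N + (k - N) = k by omega] at h1
  linarith

/-! ### The averaged tail function -/

section CesaroTail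

variable {Ω : Type*} [MeasurableSpace Ω] (μ : Measure Ω) (X : ℕ → Ω → ℝ)

lemma cesaroTail_nonneg (x : ℝ) : 0 ≤ cesaroTail μ X x :=
  Real.iSup_nonneg fun n => by positivity

variable [IsProbabilityMeasure μ]

lemma cesaro_le_one (x : ℝ) (n : ℕ+) :
    (1 / (n : ℝ)) * ∑ i ∈ Finset.Icc 1 (n : ℕ), μ.real {ω | x < |X i ω|} ≤ 1 := by
  have hn : (0 : ℝ) < n := by exact_mod_cast n.pos
  rw [one_div, inv_mul_le_iff₀ hn, mul_one]
  refine (Finset.sum_le_card_nsmul _ _ 1 fun i _ => measureReal_le_one).trans ?_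
  simp

lemma bddAbove_cesaro (x : ℝ) : BddAbove (Set.range fun n : ℕ+ =>
    (1 / (n : ℝ)) * ∑ i ∈ Finset.Icc 1 (n : ℕ), μ.real {ω | x < |X i ω|}) :=
  ⟨1, by rintro _ ⟨n, rfl⟩; exact cesaro_le_one μ X x n⟩

lemma sum_measureReal_le_mul_cesaroTail (x : ℝ) (n : ℕ) :
    ∑ i ∈ Finset.Icc 1 n, μ.real {ω | x < |X i ω|} ≤ n * cesaroTail μ X x := by
  rcases Nat.eq_zero_or_pos n with rfl | hn
  · simp
  have h := le_ciSup (bddAbove_cesaro μ X x) ⟨n, hn⟩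
  have hn' : (0 : ℝ) < n := by exact_mod_cast hn
  simp only [PNat.mk_coe] at h
  rw [one_div, inv_mul_le_iff₀ hn'] at h
  exact h

lemma cesaroTail_antitone : Antitone (cesaroTail μ X) := by
  intro x y hxy
  refine ciSup_mono (bddAbove_cesaro μ X x) fun n => ?_
  refine mul_le_mul_of_nonneg_left (Finset.sum_le_sum fun i _ => ?_) (by positivity)
  exact measureReal_mono (fun ω hω => hxy.trans_lt hω) (measure_ne_top _ _)

end CesaroTail

/-! ### The norming sequence along powers of two -/

/-- A sequence `b` that grows geometrically, at a rate above `√2` and at most about `2`, with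
`∑ 2 ^ k * G (b k)` finite. -/
structure IsBlockNorming (G : ℝ → ℝ) (b : ℕ → ℝ) (k₀ : ℕ) (q K : ℝ) : Prop where
  one_lt : 1 < q
  two_lt_sq : 2 < q ^ 2
  pos : ∀ k ≥ k₀, 0 < b k
  mul_le_succ : ∀ k ≥ k₀, q * b k ≤ b (k + 1)
  succ_le : ∀ k ≥ k₀, b (k + 1) ≤ 4 * b k
  almost_antitone : ∀ k ≥ k₀, ∀ j ≥ k, b j / 2 ^ j ≤ K * (b k / 2 ^ k)
  summable : Summable fun k => 2 ^ k * G (b k)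

lemma tendsto_atTop_of_mul_le_succ {b : ℕ → ℝ} {k₀ : ℕ} {q : ℝ} (hq : 1 < q)
    (hpos : ∀ k ≥ k₀, 0 < b k) (hb : ∀ k ≥ k₀, q * b k ≤ b (k + 1)) : Tendsto b atTop atTop := by
  have hind : ∀ k, q ^ k * b k₀ ≤ b (k + k₀) := by
    intro k
    induction k with
    | zero => simp
    | succ k ih =>
      calc q ^ (k + 1) * b k₀ = q * (q ^ k * b k₀) := by ring
        _ ≤ q * b (k + k₀) := by gcongr
        _ ≤ b (k + k₀ + 1) := hb _ (by omega)
        _ = b (k + 1 + k₀) := by congr 1; omega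
  rw [← tendsto_add_atTop_iff_nat k₀]
  exact tendsto_atTop_mono hind
    ((tendsto_pow_atTop_atTop_of_one_lt hq).atTop_mul_const (hpos k₀ le_rfl))

/-- Integral test on unequal intervals: `e k` is at most the integral of `f` over `(b k, b (k +
1)]`, and these intervals are disjoint. -/
lemma summable_of_le_mul_integrand {f : ℝ → ℝ} {b e : ℕ → ℝ} (hf : IntegrableOn f (Set.Ioi 0))
    (hpos : ∀ k, 0 < b k) (hlt : ∀ k, b k < b (k + 1)) (he : ∀ k, 0 ≤ e k)
    (hef : ∀ k, ∀ x ∈ Set.Ioc (b k) (b (k + 1)), e k ≤ (b (k + 1) - b k) * f x) :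
    Summable e := by
  have hmono : Monotone b := monotone_nat_of_le_succ fun k => (hlt k).le
  have hd : Pairwise (Function.onFun Disjoint fun k => Set.Ioc (b k) (b (k + 1))) :=
    hmono.pairwise_disjoint_on_Ioc_succ
  have hsub : ⋃ k, Set.Ioc (b k) (b (k + 1)) ⊆ Set.Ioi 0 :=
    Set.iUnion_subset fun k x hx => (hpos k).trans hx.1
  have hs := (hasSum_integral_iUnion (fun k => measurableSet_Ioc) hd (hf.mono_set hsub)).summable
  refine hs.of_nonneg_of_le he fun k => ?_
  have hk : 0 < b (k + 1) - b k := sub_pos.mpr (hlt k)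
  have h1 := setIntegral_mono_on (μ := volume) (f := fun _ => e k / (b (k + 1) - b k)) (g := f)
    (s := Set.Ioc (b k) (b (k + 1))) (by simp)
    (hf.mono_set ((Set.subset_iUnion (fun k => Set.Ioc (b k) (b (k + 1))) k).trans hsub))
    measurableSet_Ioc (fun x hx => by rw [div_le_iff₀' hk]; exact hef k x hx)
  refine le_trans (le_of_eq ?_) h1
  rw [setIntegral_const, Real.volume_real_Ioc_of_le (hlt k).le, smul_eq_mul]
  field_simp

variable {p : ℝ} {L M : ℝ → ℝ}

/-- The norming function `t ^ (1 / p) * M (t ^ (1 / p))`. -/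
def norming (p : ℝ) (M : ℝ → ℝ) (t : ℝ) : ℝ := t ^ (1 / p) * M (t ^ (1 / p))

lemma tendsto_two_pow_rpow (hp : 1 ≤ p) :
    Tendsto (fun k : ℕ => ((2 : ℝ) ^ k) ^ (1 / p)) atTop atTop :=
  (tendsto_rpow_atTop (by positivity)).comp (tendsto_pow_atTop_atTop_of_one_lt one_lt_two)

lemma tendsto_norming_ratio (hp : 1 ≤ p) (hM : SlowlyVarying M) :
    Tendsto (fun k : ℕ => norming p M (2 ^ (k + 1)) / norming p M (2 ^ k)) atTop
      (𝓝 (2 ^ (1 / p))) := by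
  have h := ((hM.2 (2 ^ (1 / p)) (by positivity)).comp
    (tendsto_two_pow_rpow hp)).const_mul ((2 : ℝ) ^ (1 / p))
  rw [mul_one] at h
  refine h.congr fun k => ?_
  have : (0 : ℝ) < ((2 : ℝ) ^ k) ^ (1 / p) := by positivity
  simp only [Function.comp, norming]
  rw [pow_succ, Real.mul_rpow (by positivity) (by positivity), mul_comm (((2 : ℝ) ^ k) ^ (1 / p))]
  field_simp

lemma eventually_norming_pos (hp : 1 ≤ p) (hM : SlowlyVarying M) :
    ∀ᶠ k : ℕ in atTop, 0 < norming p M (2 ^ k) := by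
  filter_upwards [(tendsto_two_pow_rpow hp).eventually hM.eventually_pos] with k hk
  exact mul_pos (by positivity) hk

/-- The ratio of `n` to the power of two below it varies with `n`, so slow variation is needed
uniformly in the ratio. -/
lemma eventually_norming_log_le (hp : 1 ≤ p) (hM : SlowlyVarying M) :
    ∀ᶠ n : ℕ in atTop, norming p M (2 ^ Nat.log 2 n) ≤ 2 * norming p M n := by
  have hp0 : 0 < p := by linarith
  have hlog : Tendsto (Nat.log 2) atTop atTop :=
    tendsto_atTop_atTop.mpr fun k => ⟨2 ^ k, fun n hn =>
      Nat.le_log_of_pow_le one_lt_two hn⟩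
  filter_upwards [hlog.eventually ((tendsto_two_pow_rpow hp).eventually
    (hM.eventually_bounds.and hM.eventually_pos)), eventually_ge_atTop 1] with n hn hn1
  set t : ℝ := 2 ^ Nat.log 2 n
  have ht : 0 < t := by positivity
  have h1 : t ≤ n := by
    have := Nat.pow_log_le_self 2 (x := n) (by omega)
    simp only [t]; exact_mod_cast this
  have h2 : (n : ℝ) ≤ 2 * t := by
    have := (Nat.lt_pow_succ_log_self one_lt_two n).le
    rw [pow_succ'] at this
    simp only [t]
    exact_mod_cast this
  have hc1 : 1 ≤ n / t := (one_le_div ht).mpr h1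
  have hc2 : n / t ≤ 2 := (div_le_iff₀ ht).mpr h2
  have hpp : 0 ≤ 1 / p := by positivity
  have h3 : (n : ℝ) ^ (1 / p) = (n / t) ^ (1 / p) * t ^ (1 / p) := by
    rw [← Real.mul_rpow (by positivity) (by positivity)]; field_simp
  have h4 : (1 : ℝ) ≤ (n / t) ^ (1 / p) := Real.one_le_rpow hc1 hpp
  have h5 : (n / t) ^ (1 / p) ≤ 4 :=
    (Real.rpow_le_self_of_one_le hc1 (by rw [div_le_one hp0]; exact hp)).trans (by linarith)
  have h6 := (hn.1 _ ⟨h4, h5⟩).1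
  have hpos := hn.2
  unfold norming
  rw [h3]
  have ht' : 0 < t ^ (1 / p) := by positivity
  set c := ((n : ℝ) / t) ^ (1 / p)
  have h7 : 0 < M (c * t ^ (1 / p)) := by linarith
  calc t ^ (1 / p) * M (t ^ (1 / p)) ≤ t ^ (1 / p) * (2 * M (c * t ^ (1 / p))) := by gcongr
    _ ≤ c * t ^ (1 / p) * (2 * M (c * t ^ (1 / p))) := by
      gcongr; exact le_mul_of_one_le_left ht'.le h4
    _ = _ := by ring

lemma exists_isBlockNorming (hp1 : 1 ≤ p) (hp2 : p < 2) (hL : SlowlyVarying L)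
    (hM : IsDeBruijnConjugate L M) (hLp : p = 1 → MonotoneOn L (Set.Ici 0)) {G : ℝ → ℝ}
    (hG0 : ∀ x, 0 ≤ G x) (hGa : Antitone G)
    (hG : IntegrableOn (fun x : ℝ => x ^ (p - 1) * L x ^ p * G x) (Set.Ioi 0)) :
    ∃ k₀ q K, IsBlockNorming G (fun k => norming p M (2 ^ k)) k₀ q K := by
  have hp0 : 0 < p := by linarith
  have h2p : (2 : ℝ) ^ (1 / p) ≤ 2 := Real.rpow_le_self_of_one_le (by norm_num)
    (by rw [div_le_one hp0]; exact hp1)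
  have hsq : √2 < (2 : ℝ) ^ (1 / p) := by
    rw [Real.sqrt_eq_rpow]
    exact Real.rpow_lt_rpow_of_exponent_lt one_lt_two (by gcongr)
  -- The ratios `b (k + 1) / b k` tend to `2 ^ (1 / p)`, so any smaller `q` is eventually a growth
  -- rate; `q > √2` gives `q ^ 2 > 2`.
  obtain ⟨q, hq1, hq2⟩ := exists_between hsq
  have hs2 : (1 : ℝ) < √2 := by rw [Real.lt_sqrt zero_le_one]; norm_num
  have hq : 1 < q := hs2.trans hq1
  have hqsq : 2 < q ^ 2 := (Real.sqrt_lt' (by linarith)).mp hq1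
  set b : ℕ → ℝ := fun k => norming p M (2 ^ k) with hb
  have hrat := tendsto_norming_ratio hp1 hM.1
  have hev : ∀ᶠ k in atTop, 0 < b k ∧ q * b k ≤ b (k + 1) ∧ b (k + 1) ≤ 4 * b k := by
    filter_upwards [eventually_norming_pos hp1 hM.1, hrat.eventually (lt_mem_nhds hq2),
      hrat.eventually (gt_mem_nhds (show (2 : ℝ) ^ (1 / p) < 4 by linarith))] with k h1 h2 h3
    refine ⟨h1, ?_, ?_⟩
    · rw [lt_div_iff₀ h1] at h2; exact h2.le
    · rw [div_lt_iff₀ h1] at h3; exact h3.le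
  obtain ⟨k₁, hk₁⟩ := eventually_atTop.mp hev
  have hbtop : Tendsto b atTop atTop := tendsto_atTop_of_mul_le_succ hq
    (fun k hk => (hk₁ k hk).1) (fun k hk => (hk₁ k hk).2.1)
  have hconj : Tendsto (fun k : ℕ => M (((2 : ℝ) ^ k) ^ (1 / p)) * L (b k)) atTop (𝓝 1) :=
    hM.2.2.comp (tendsto_two_pow_rpow hp1)
  have hbL : ∀ᶠ k : ℕ in atTop, ((2 : ℝ) ^ k) ^ (1 / p) ≤ 2 * (b k * L (b k)) ∧
      b k * L (b k) ≤ 2 * ((2 : ℝ) ^ k) ^ (1 / p) := by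
    filter_upwards [hconj.eventually (lt_mem_nhds (show (1 / 2 : ℝ) < 1 by norm_num)),
      hconj.eventually (gt_mem_nhds one_lt_two)] with k h1 h2
    have : (0 : ℝ) < ((2 : ℝ) ^ k) ^ (1 / p) := by positivity
    have e : b k * L (b k) = ((2 : ℝ) ^ k) ^ (1 / p) * (M (((2 : ℝ) ^ k) ^ (1 / p)) * L (b k)) := by
      simp only [hb, norming]; ring
    rw [e]
    constructor <;> nlinarith
  have hpow : ∀ k : ℕ, (((2 : ℝ) ^ k) ^ (1 / p)) ^ p = 2 ^ k := fun k => by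
    rw [← Real.rpow_mul (by positivity), one_div_mul_cancel hp0.ne', Real.rpow_one]
  obtain ⟨k₂, hk₂⟩ := eventually_atTop.mp (hbL.and (hbtop.eventually
    (hL.eventually_bounds.and hL.eventually_pos)))
  have hsum : Summable fun k => 2 ^ k * G (b k) := by
    rw [← summable_nat_add_iff (max k₁ k₂ + 1)]
    -- The term of index `m + 1` is compared with the integral over `(b m, b (m + 1)]`, where `G` is
    -- at least `G (b (m + 1))`. The constant collects `(q - 1) * b m ≤ b (m + 1) - b m`, the index
    -- shift, and two factors 2 raised to the power `p`: one from conjugacy, one from replacing `L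
    -- (b m)` by `L x`.
    have hc : 0 < (q - 1) * 2⁻¹ * (4 ^ p)⁻¹ := by
      have : 0 < q - 1 := by linarith
      positivity
    rw [← summable_mul_left_iff hc.ne']
    refine summable_of_le_mul_integrand (b := fun k => b (k + max k₁ k₂)) hG
      (fun k => (hk₁ _ (by omega)).1) (fun k => ?_)
      (fun k => mul_nonneg hc.le (mul_nonneg (by positivity) (hG0 _))) fun k x hx => ?_
    · have := hk₁ (k + max k₁ k₂) (by omega)
      rw [show k + 1 + max k₁ k₂ = k + max k₁ k₂ + 1 by ring]
      nlinarith [this.1, this.2.1]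
    · rw [show k + 1 + max k₁ k₂ = k + max k₁ k₂ + 1 by ring] at hx ⊢
      rw [show k + (max k₁ k₂ + 1) = k + max k₁ k₂ + 1 by ring]
      obtain ⟨a1, a2, a3⟩ := hk₁ (k + max k₁ k₂) (by omega)
      obtain ⟨⟨c1, -⟩, c3, c4⟩ := hk₂ (k + max k₁ k₂) (by omega)
      generalize k + max k₁ k₂ = m at *
      have hx0 : 0 < x := a1.trans hx.1
      have hxc := (c3 (x / b m) ⟨(one_le_div a1).mpr hx.1.le,
        (div_le_iff₀ a1).mpr (hx.2.trans a3)⟩).1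
      rw [div_mul_cancel₀ _ a1.ne'] at hxc
      have hLx : 0 < L x := by linarith
      have key : (2 : ℝ) ^ m ≤ 4 ^ p * (b m * (x ^ (p - 1) * L x ^ p)) := by
        calc (2 : ℝ) ^ m = (((2 : ℝ) ^ m) ^ (1 / p)) ^ p := (hpow m).symm
          _ ≤ (4 * (b m * L x)) ^ p := by
            gcongr
            nlinarith
          _ = 4 ^ p * (b m * (b m ^ (p - 1) * L x ^ p)) := by
            rw [Real.mul_rpow (by norm_num) (by positivity), Real.mul_rpow a1.le hLx.le,
              ← mul_assoc (b m), ← Real.rpow_one_add' a1.le (by linarith), add_sub_cancel]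
          _ ≤ _ := by
            have := Real.rpow_le_rpow a1.le hx.1.le (show 0 ≤ p - 1 by linarith)
            gcongr
      have hGx : G (b (m + 1)) ≤ G x := hGa hx.2
      have h4 : (0 : ℝ) < 4 ^ p := by positivity
      calc (q - 1) * 2⁻¹ * (4 ^ p)⁻¹ * (2 ^ (m + 1) * G (b (m + 1)))
          = (q - 1) * (4 ^ p)⁻¹ * G (b (m + 1)) * 2 ^ m := by ring
        _ ≤ (q - 1) * (4 ^ p)⁻¹ * G (b (m + 1)) * (4 ^ p * (b m * (x ^ (p - 1) * L x ^ p))) := by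
          have : 0 < q - 1 := by linarith
          have := hG0 (b (m + 1))
          gcongr
        _ = ((q - 1) * b m) * (x ^ (p - 1) * L x ^ p * G (b (m + 1))) := by field_simp
        _ ≤ (b (m + 1) - b m) * (x ^ (p - 1) * L x ^ p * G x) := by
          have h5 := hG0 (b (m + 1))
          have h6 : (q - 1) * b m ≤ b (m + 1) - b m := by linarith
          have h7 : 0 ≤ (q - 1) * b m := mul_nonneg (by linarith) a1.le
          exact mul_le_mul h6 (by gcongr) (mul_nonneg (by positivity) h5) (h7.trans h6)
  suffices hK : ∃ k₀ K, ∀ k ≥ k₀, ∀ j ≥ k, b j / 2 ^ j ≤ K * (b k / 2 ^ k) by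
    obtain ⟨k₀, K, hK⟩ := hK
    exact ⟨max k₀ k₁, q, K, hq, hqsq, fun k hk => (hk₁ k (by omega)).1,
      fun k hk => (hk₁ k (by omega)).2.1, fun k hk => (hk₁ k (by omega)).2.2,
      fun k hk => hK k (by omega), hsum⟩
  -- For `p > 1` the ratios of `b` tend to a limit below 2, so `b k / 2 ^ k` eventually decreases.
  -- For `p = 1` the limit is 2 and decides nothing; instead `b k / 2 ^ k` is within a factor 2 of
  -- `1 / L (b k)`, and `L` is monotone.
  rcases hp1.eq_or_lt with rfl | hp1
  · refine ⟨max k₁ k₂, 4, fun k hk j hj => ?_⟩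
    obtain ⟨⟨-, c1⟩, -, c2⟩ := hk₂ j (by omega)
    obtain ⟨⟨c3, -⟩, -, c4⟩ := hk₂ k (by omega)
    obtain ⟨d1, -⟩ := hk₁ k (by omega)
    have hmon : b k ≤ b j := by
      refine Nat.le_induction le_rfl (fun n hn ih => ih.trans ?_) j hj
      have := hk₁ n (by omega)
      nlinarith [this.1, this.2.1]
    have hLL := hLp rfl (Set.mem_Ici.mpr d1.le) (Set.mem_Ici.mpr (d1.le.trans hmon)) hmon
    simp only [div_one, Real.rpow_one] at c1 c3
    have e1 : b j / 2 ^ j ≤ 2 / L (b j) := by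
      rw [div_le_div_iff₀ (by positivity) c2]; linarith
    have e2 : 2 / L (b k) ≤ 4 * (b k / 2 ^ k) := by
      rw [mul_div_assoc', div_le_div_iff₀ c4 (by positivity)]; linarith
    exact e1.trans (le_trans (by gcongr) e2)
  · have hlt : (2 : ℝ) ^ (1 / p) < 2 := Real.rpow_lt_self_of_one_lt one_lt_two
      (by rw [div_lt_one hp0]; exact hp1)
    obtain ⟨k₃, hk₃⟩ := eventually_atTop.mp (hrat.eventually (gt_mem_nhds hlt))
    refine ⟨max k₁ k₃, 1, fun k hk j hj => ?_⟩
    rw [one_mul]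
    refine Nat.le_induction le_rfl (fun n hn ih => le_trans ?_ ih) j hj
    have h1 := hk₃ n (by omega)
    rw [div_lt_iff₀ (hk₁ n (by omega)).1] at h1
    rw [div_le_div_iff₀ (by positivity) (by positivity), pow_succ]
    have : (0 : ℝ) < 2 ^ n := by positivity
    simp only [hb] 
    nlinarith

/-! ### Truncation and its pointwise bounds along the norming sequence -/

lemma trunc_eq_max_min {a : ℝ} (ha : 0 < a) (y : ℝ) : trunc a y = max (-a) (min a y) := by
  unfold trunc
  rcases lt_or_ge y (-a) with h1 | h1
  · rw [if_pos h1, if_neg (by rw [abs_le]; intro h; linarith [h.1]), if_neg (by linarith),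
      min_eq_right (by linarith), max_eq_left h1.le]
    ring
  rcases lt_or_ge a y with h2 | h2
  · rw [if_neg h1.not_gt, if_neg (by rw [abs_le]; intro h; linarith [h.2]), if_pos h2,
      min_eq_left h2.le, max_eq_right (by linarith)]
    ring
  · rw [if_neg h1.not_gt, if_pos (abs_le.mpr ⟨h1, h2⟩), if_neg h2.not_gt, min_eq_right h2,
      max_eq_right h1]
    ring

lemma trunc_of_abs_le {a y : ℝ} (ha : 0 < a) (h : |y| ≤ a) : trunc a y = y := by
  rw [abs_le] at h
  rw [trunc_eq_max_min ha, min_eq_right h.2, max_eq_right h.1]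

lemma abs_trunc_le {a : ℝ} (ha : 0 < a) (y : ℝ) : |trunc a y| ≤ a := by
  rw [trunc_eq_max_min ha, abs_le]
  exact ⟨le_max_left _ _, max_le (by linarith) (min_le_left _ _)⟩

lemma abs_sub_trunc_le {a : ℝ} (ha : 0 < a) (y : ℝ) : |y - trunc a y| ≤ |y| := by
  rw [trunc_eq_max_min ha]
  rcases max_cases (-a) (min a y) with ⟨h, h'⟩ | ⟨h, h'⟩ <;>
  rcases min_cases a y with ⟨h1, h1'⟩ | ⟨h1, h1'⟩ <;> rw [h] <;>
  rcases abs_cases y with ⟨h2, h2'⟩ | ⟨h2, h2'⟩ <;> rw [h2, abs_le] <;> constructor <;> linarith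

lemma continuous_trunc {a : ℝ} (ha : 0 < a) : Continuous (trunc a) := by
  rw [show trunc a = fun y => max (-a) (min a y) from funext (trunc_eq_max_min ha)]
  fun_prop

namespace IsBlockNorming

variable {G : ℝ → ℝ} {b : ℕ → ℝ} {k₀ : ℕ} {q K : ℝ}

lemma le_succ (h : IsBlockNorming G b k₀ q K) {k : ℕ} (hk : k₀ ≤ k) : b k ≤ b (k + 1) := by
  nlinarith [h.one_lt, h.mul_le_succ k hk, h.pos k hk]

lemma tendsto_atTop (h : IsBlockNorming G b k₀ q K) : Tendsto b atTop atTop :=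
  tendsto_atTop_of_mul_le_succ h.one_lt h.pos h.mul_le_succ

lemma K_nonneg (h : IsBlockNorming G b k₀ q K) : 0 ≤ K := by
  have h1 := h.almost_antitone k₀ le_rfl k₀ le_rfl
  have h2 : 0 < b k₀ / 2 ^ k₀ := div_pos (h.pos k₀ le_rfl) (by positivity)
  nlinarith

/-- Raising the level from `b j` to `b (j + 1)` matters only when `|y| > b j`, and then the new
square is at most `b (j + 1) ^ 2`. -/
lemma trunc_sq_le (h : IsBlockNorming G b k₀ q K) (y : ℝ) {k : ℕ} (hk : k₀ ≤ k) :
    trunc (b k) y ^ 2 ≤ b k₀ ^ 2 + ∑ j ∈ Finset.Ico k₀ k,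
      b (j + 1) ^ 2 * {z : ℝ | b j < |z|}.indicator 1 y := by
  induction k, hk using Nat.le_induction with
  | base =>
    simpa using (sq_le_sq' (abs_le.mp (abs_trunc_le (h.pos _ le_rfl) y)).1
      (abs_le.mp (abs_trunc_le (h.pos _ le_rfl) y)).2)
  | succ k hk ih =>
    rw [Finset.sum_Ico_succ_top hk, ← add_assoc]
    have hp := h.pos k hk
    have hp' := h.pos (k + 1) (by omega)
    by_cases hy : b k < |y|
    · rw [Set.indicator_of_mem (show y ∈ {z : ℝ | b k < |z|} from hy)]
      have h1 := abs_le.mp (abs_trunc_le hp' y)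
      have h2 := sq_le_sq' h1.1 h1.2
      have h3 : 0 ≤ trunc (b k) y ^ 2 := sq_nonneg _
      simp only [Pi.one_apply]
      linarith
    · rw [Set.indicator_of_notMem (show y ∉ {z : ℝ | b k < |z|} from hy)]
      have hy := not_lt.mp hy
      rw [trunc_of_abs_le hp' (hy.trans (h.le_succ hk))]
      rw [trunc_of_abs_le hp hy] at ih
      linarith

/-- One term suffices: the one with `b (k + j) < |y| ≤ b (k + j + 1)`. -/
lemma ofReal_abs_sub_trunc_le (h : IsBlockNorming G b k₀ q K) (y : ℝ) {k : ℕ} (hk : k₀ ≤ k) :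
    ENNReal.ofReal |y - trunc (b k) y| ≤
      ∑' j, ENNReal.ofReal (b (k + j + 1)) * {z : ℝ | b (k + j) < |z|}.indicator 1 y := by
  by_cases hy : |y| ≤ b k
  · rw [trunc_of_abs_le (h.pos k hk) hy]; simp
  have hex : ∃ j, |y| ≤ b (k + j) := by
    obtain ⟨N, hN⟩ := eventually_atTop.mp (h.tendsto_atTop.eventually_ge_atTop |y|)
    exact ⟨N, hN _ (by omega)⟩
  classical
  obtain ⟨j, hj⟩ : ∃ j, Nat.find hex = j + 1 := Nat.exists_eq_succ_of_ne_zero fun h0 => by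
    have := Nat.find_spec hex
    rw [h0] at this
    exact hy this
  have h1 := Nat.find_spec hex
  have h2 := Nat.find_min hex (m := j) (by omega)
  rw [hj] at h1
  refine le_trans ?_ (ENNReal.le_tsum j)
  rw [Set.indicator_of_mem (show y ∈ {z : ℝ | b (k + j) < |z|} from not_le.mp h2)]
  simp only [Pi.one_apply, mul_one]
  exact ENNReal.ofReal_le_ofReal ((abs_sub_trunc_le (h.pos k hk) y).trans h1)

/-- The second moment of the truncation at `b k`, up to a constant. -/
lemma summable_variance (h : IsBlockNorming G b k₀ q K) (hG : ∀ x, 0 ≤ G x) (c : ℝ) (hc : 0 ≤ c) :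
    Summable fun k => 2 ^ k / b k ^ 2 * (c + ∑ j ∈ Finset.Ico k₀ k, b (j + 1) ^ 2 * G (b j)) := by
  rw [← summable_nat_add_iff k₀]
  have hq0 : 0 < q := by linarith [h.one_lt]
  have hu : ∀ k, 0 ≤ c + ∑ j ∈ Finset.Ico k₀ k, b (j + 1) ^ 2 * G (b j) := fun k =>
    add_nonneg hc (Finset.sum_nonneg fun j _ => mul_nonneg (sq_nonneg _) (hG _))
  -- Instead of exchanging sums: one step multiplies the prefactor `2 ^ k / b k ^ 2` by at most `2 /
  -- q ^ 2 < 1`, and the new summand contributes exactly `2 * (2 ^ k * G (b k))`.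
  refine summable_of_succ_le_mul_add (r := 2 / q ^ 2)
    (e := fun k => 2 * (2 ^ (k + k₀) * G (b (k + k₀))))
    ((div_lt_one (by positivity)).mpr h.two_lt_sq)
    (fun k => mul_nonneg (by positivity) (hu _))
    (fun k => mul_nonneg two_pos.le (mul_nonneg (by positivity) (hG _)))
    (((summable_nat_add_iff k₀).mpr h.summable).mul_left 2) fun k => ?_
  have hk : k₀ ≤ k + k₀ := by omega
  rw [show k + 1 + k₀ = k + k₀ + 1 by ring]
  generalize k + k₀ = m at *
  have hp := h.pos m hk
  have hp' := h.pos (m + 1) (by omega)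
  rw [Finset.sum_Ico_succ_top hk, ← add_assoc, mul_add]
  refine add_le_add ?_ (le_of_eq ?_)
  · rw [← mul_assoc]
    refine mul_le_mul_of_nonneg_right ?_ (hu m)
    rw [div_mul_div_comm, div_le_div_iff₀ (by positivity) (by positivity), pow_succ]
    have := pow_le_pow_left₀ (by positivity) (h.mul_le_succ m hk) 2
    rw [mul_pow] at this
    have h2 : (0 : ℝ) < 2 ^ m * 2 := by positivity
    nlinarith
  · field_simp; ring

end IsBlockNorming

/-! ### From dyadic blocks to all partial sums -/

section Deterministic

variable {G : ℝ → ℝ} {b : ℕ → ℝ} {k₀ : ℕ} {q K : ℝ}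

lemma sum_Icc_add_sum_Icc (x : ℕ → ℝ) (k l : ℕ) :
    ∑ i ∈ Finset.Icc 1 (2 ^ k - 1 + l), x i = ∑ i ∈ Finset.Icc 1 (2 ^ k - 1), x i +
      ∑ i ∈ Finset.Icc (2 ^ k - 1 + 1) (2 ^ k - 1 + l), x i := by
  have h (m n : ℕ) : Finset.Icc (m + 1) n = Finset.Ioc m n := by ext; simp
  rw [h, show 1 = 0 + 1 from rfl, h, h, Finset.sum_Ioc_consecutive _ (by omega) (by omega)]

/-- The normed sums at block ends satisfy `t (k + 1) ≤ q⁻¹ * (t k + e k)`, hence vanish; inside a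
block one more `e k` is added. -/
lemma tendsto_sum_div_of_block (h : IsBlockNorming G b k₀ q K) {x e : ℕ → ℝ}
    (he : Tendsto e atTop (𝓝 0))
    (hx : ∀ᶠ k in atTop, ∀ l, 1 ≤ l → l ≤ 2 ^ k →
      |∑ i ∈ Finset.Icc (2 ^ k - 1 + 1) (2 ^ k - 1 + l), x i| ≤ e k * b k) :
    Tendsto (fun n : ℕ => (∑ i ∈ Finset.Icc 1 n, x i) / b (Nat.log 2 n)) atTop (𝓝 0) := by
  have hq0 : 0 < q := by linarith [h.one_lt]
  -- The absolute value on `b k` keeps the sequence nonnegative below `k₀`, where the sign of `b` is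
  -- unknown.
  have ht : Tendsto (fun k => |∑ i ∈ Finset.Icc 1 (2 ^ k - 1), x i| / |b k|) atTop (𝓝 0) := by
    refine tendsto_zero_of_succ_le_mul_add (r := q⁻¹) (e := fun k => q⁻¹ * e k) (by positivity)
      (inv_lt_one_of_one_lt₀ h.one_lt) (fun k => by positivity)
      (by simpa using he.const_mul q⁻¹) ?_
    filter_upwards [hx, eventually_ge_atTop k₀] with k hk hk0
    have hp := h.pos k hk0
    have hp' := h.pos (k + 1) (by omega)
    have hm := h.mul_le_succ k hk0
    have h1 := hk (2 ^ k) (Nat.one_le_two_pow) le_rfl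
    have h2 : 2 ^ (k + 1) - 1 = 2 ^ k - 1 + 2 ^ k := by
      have := Nat.one_le_two_pow (n := k)
      rw [pow_succ]; omega
    rw [h2, sum_Icc_add_sum_Icc, abs_of_pos hp, abs_of_pos hp', ← mul_add, div_le_iff₀ hp']
    set S := ∑ i ∈ Finset.Icc 1 (2 ^ k - 1), x i
    have h3 : 0 ≤ |S| / b k + e k := by
      have h4 : 0 ≤ e k := nonneg_of_mul_nonneg_left ((abs_nonneg _).trans h1) hp
      positivity
    calc _ ≤ |S| + e k * b k := (abs_add_le _ _).trans (by gcongr)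
      _ = q⁻¹ * (|S| / b k + e k) * (q * b k) := by field_simp
      _ ≤ _ := by gcongr
  have hlog : Tendsto (Nat.log 2) atTop atTop :=
    tendsto_atTop_atTop.mpr fun k => ⟨2 ^ k, fun n hn => Nat.le_log_of_pow_le one_lt_two hn⟩
  have hsum := (ht.add he).comp hlog
  rw [add_zero] at hsum
  refine squeeze_zero_norm' ?_ hsum
  filter_upwards [hlog.eventually hx, hlog.eventually_ge_atTop k₀, eventually_ge_atTop 1]
    with n hn hn0 hn1
  have h1 := Nat.pow_log_le_self 2 (x := n) (by omega)
  have h2 := Nat.lt_pow_succ_log_self one_lt_two n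
  simp only [Function.comp]
  generalize Nat.log 2 n = k at *
  have h3 := Nat.one_le_two_pow (n := k)
  rw [Nat.succ_eq_add_one, pow_succ] at h2
  obtain ⟨l, rfl⟩ : ∃ l, n = 2 ^ k - 1 + l := ⟨n - (2 ^ k - 1), by omega⟩
  have hp := h.pos k hn0
  rw [sum_Icc_add_sum_Icc, Real.norm_eq_abs, abs_div, abs_of_pos hp, div_le_iff₀ hp, add_mul,
    div_mul_cancel₀ _ hp.ne']
  exact (abs_add_le _ _).trans (by gcongr; exact hn l (by omega) (by omega))

end Deterministic

/-- By Tonelli the sum of the `f k` has finite integral, so it is almost surely finite and its terms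
vanish. -/
lemma ae_tendsto_zero_of_summable_integral {Ω : Type*} [MeasurableSpace Ω] {μ : Measure Ω}
    {f : ℕ → Ω → ℝ} (hf : ∀ k, Integrable (f k) μ) (h0 : ∀ k ω, 0 ≤ f k ω)
    (hs : Summable fun k => ∫ ω, f k ω ∂μ) : ∀ᵐ ω ∂μ, Tendsto (fun k => f k ω) atTop (𝓝 0) := by
  have hm : ∀ k, AEMeasurable (fun ω => ENNReal.ofReal (f k ω)) μ :=
    fun k => (hf k).aemeasurable.ennreal_ofReal
  have hfin : ∫⁻ ω, ∑' k, ENNReal.ofReal (f k ω) ∂μ ≠ ⊤ := by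
    rw [lintegral_tsum hm]
    simp_rw [← ofReal_integral_eq_lintegral_ofReal (hf _) (.of_forall (h0 _))]
    exact hs.tsum_ofReal_ne_top
  filter_upwards [ae_lt_top' (AEMeasurable.tsum hm) hfin] with ω hω
  have := ENNReal.tendsto_atTop_zero_of_tsum_ne_top hω.ne
  rw [← ENNReal.ofReal_zero] at this
  have h2 := (ENNReal.tendsto_toReal ENNReal.ofReal_ne_top).comp this
  simpa [Function.comp_def, ENNReal.toReal_ofReal (h0 _ _)] using h2

/-! ### Probability estimates on a dyadic block -/

section Block

variable {Ω : Type*} [MeasurableSpace Ω] {μ : Measure Ω} {X : ℕ → Ω → ℝ}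
  {b : ℕ → ℝ} {k₀ : ℕ} {q K : ℝ}

lemma sum_block_measureReal_le [IsProbabilityMeasure μ] (x : ℝ) (k : ℕ) :
    ∑ i ∈ Finset.Icc (2 ^ k - 1 + 1) (2 ^ k - 1 + 2 ^ k), μ.real {ω | x < |X i ω|} ≤
      2 ^ (k + 1) * cesaroTail μ X x := by
  have h := sum_measureReal_le_mul_cesaroTail μ X x (2 ^ (k + 1))
  push_cast at h
  refine le_trans (Finset.sum_le_sum_of_subset_of_nonneg (fun i hi => ?_)
    fun _ _ _ => measureReal_nonneg) h
  rw [Finset.mem_Icc] at hi ⊢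
  rw [pow_succ]
  omega

lemma ae_eventually_abs_le [IsProbabilityMeasure μ] (h : IsBlockNorming (cesaroTail μ X) b k₀ q K) :
    ∀ᵐ ω ∂μ, ∀ᶠ k in atTop, ∀ i ∈ Finset.Icc (2 ^ k - 1 + 1) (2 ^ k - 1 + 2 ^ k),
      |X i ω| ≤ b k := by
  let s : ℕ → Set Ω := fun k =>
    ⋃ i ∈ Finset.Icc (2 ^ k - 1 + 1) (2 ^ k - 1 + 2 ^ k), {ω | b k < |X i ω|}
  have hs : ∀ k, μ (s k) ≤ ENNReal.ofReal (2 * (2 ^ k * cesaroTail μ X (b k))) := by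
    intro k
    refine (measure_biUnion_finset_le _ _).trans ?_
    simp_rw [← ofReal_measureReal (measure_ne_top μ _)]
    rw [← ENNReal.ofReal_sum_of_nonneg fun _ _ => measureReal_nonneg]
    refine ENNReal.ofReal_le_ofReal ((sum_block_measureReal_le _ _).trans (le_of_eq ?_))
    ring
  have hfin : ∑' k, μ (s k) ≠ ⊤ :=
    ne_top_of_le_ne_top (h.summable.mul_left 2).tsum_ofReal_ne_top (ENNReal.tsum_le_tsum hs)
  filter_upwards [ae_eventually_notMem hfin] with ω hω
  filter_upwards [hω] with k hk i hi
  by_contra hcon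
  exact hk (Set.mem_biUnion hi (not_le.mp hcon))

lemma integrable_trunc [IsProbabilityMeasure μ]
    {Y : Ω → ℝ} (hY : AEStronglyMeasurable Y μ) {a : ℝ} (ha : 0 < a) :
    Integrable (fun ω => trunc a (Y ω)) μ :=
  .of_bound ((continuous_trunc ha).comp_aestronglyMeasurable hY) a
    (.of_forall fun _ => abs_trunc_le ha _)

lemma nullMeasurableSet_lt_abs {Y : Ω → ℝ} (hY : AEStronglyMeasurable Y μ) (x : ℝ) :
    NullMeasurableSet {ω | x < |Y ω|} μ :=
  nullMeasurableSet_lt aemeasurable_const hY.aemeasurable.abs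

lemma integral_trunc_sq_le [IsProbabilityMeasure μ]
    (h : IsBlockNorming (cesaroTail μ X) b k₀ q K) {Y : Ω → ℝ}
    (hY : AEStronglyMeasurable Y μ) {k : ℕ} (hk : k₀ ≤ k) :
    ∫ ω, trunc (b k) (Y ω) ^ 2 ∂μ ≤
      b k₀ ^ 2 + ∑ j ∈ Finset.Ico k₀ k, b (j + 1) ^ 2 * μ.real {ω | b j < |Y ω|} := by
  have hind : ∀ j, Integrable ({ω | b j < |Y ω|}.indicator (1 : Ω → ℝ)) μ := fun j =>
    (integrable_const (1 : ℝ)).indicator₀ (nullMeasurableSet_lt_abs hY _)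
  have hint : Integrable (fun ω => b k₀ ^ 2 + ∑ j ∈ Finset.Ico k₀ k,
      b (j + 1) ^ 2 * {ω | b j < |Y ω|}.indicator (1 : Ω → ℝ) ω) μ :=
    (integrable_const _).add (integrable_finsetSum _ fun j _ => (hind j).const_mul _)
  refine (integral_mono_of_nonneg (.of_forall fun ω => sq_nonneg _) hint
    (.of_forall fun ω => h.trunc_sq_le (Y ω) hk)).trans (le_of_eq ?_)
  rw [integral_add (integrable_const _) (integrable_finsetSum _ fun j _ => (hind j).const_mul _),
    integral_finsetSum _ fun j _ => (hind j).const_mul _]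
  congr 1
  · simp
  · refine Finset.sum_congr rfl fun j _ => ?_
    rw [integral_const_mul, integral_indicator₀ (nullMeasurableSet_lt_abs hY _)]
    simp

lemma sum_block_integral_trunc_sq_le [IsProbabilityMeasure μ]
    (h : IsBlockNorming (cesaroTail μ X) b k₀ q K)
    (hX : ∀ i, 1 ≤ i → AEStronglyMeasurable (X i) μ) {k : ℕ} (hk : k₀ ≤ k) :
    ∑ i ∈ Finset.Icc (2 ^ k - 1 + 1) (2 ^ k - 1 + 2 ^ k), ∫ ω, trunc (b k) (X i ω) ^ 2 ∂μ ≤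
      2 ^ (k + 1) * (b k₀ ^ 2 + ∑ j ∈ Finset.Ico k₀ k, b (j + 1) ^ 2 * cesaroTail μ X (b j)) := by
  refine (Finset.sum_le_sum fun i hi => integral_trunc_sq_le h
    (hX i (by rw [Finset.mem_Icc] at hi; omega)) hk).trans ?_
  rw [Finset.sum_add_distrib, Finset.sum_comm, mul_add, Finset.mul_sum]
  refine add_le_add ?_ (Finset.sum_le_sum fun j _ => ?_)
  · rw [Finset.sum_const, Nat.card_Icc, nsmul_eq_mul]
    refine mul_le_mul_of_nonneg_right ?_ (sq_nonneg _)
    rw [Nat.add_right_comm, Nat.add_sub_cancel_left, pow_succ]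
    push_cast
    have : (0 : ℝ) < 2 ^ k := by positivity
    linarith
  · rw [← Finset.mul_sum]
    calc _ ≤ b (j + 1) ^ 2 * (2 ^ (k + 1) * cesaroTail μ X (b j)) :=
          mul_le_mul_of_nonneg_left (sum_block_measureReal_le _ _) (sq_nonneg _)
      _ = _ := by ring

/-- The maximal partial sum over the `k`-th dyadic block of the variables truncated at `a` and
centred. -/
def blockMax (μ : Measure Ω) (X : ℕ → Ω → ℝ) (a : ℝ) (k : ℕ) (ω : Ω) : ℝ :=
  (Finset.Icc 1 (2 ^ k)).sup' (Finset.nonempty_Icc.mpr Nat.one_le_two_pow) (fun l =>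
    |∑ i ∈ Finset.Icc (2 ^ k - 1 + 1) (2 ^ k - 1 + l),
      (trunc a (X i ω) - ∫ ω', trunc a (X i ω') ∂μ)|)

lemma le_blockMax (a : ℝ) {k l : ℕ} (hl : 1 ≤ l) (hlk : l ≤ 2 ^ k) (ω : Ω) :
    |∑ i ∈ Finset.Icc (2 ^ k - 1 + 1) (2 ^ k - 1 + l),
      (trunc a (X i ω) - ∫ ω', trunc a (X i ω') ∂μ)| ≤ blockMax μ X a k ω :=
  Finset.le_sup' (fun l => |∑ i ∈ Finset.Icc (2 ^ k - 1 + 1) (2 ^ k - 1 + l),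
      (trunc a (X i ω) - ∫ ω', trunc a (X i ω') ∂μ)|) (Finset.mem_Icc.mpr ⟨hl, hlk⟩)

lemma blockMax_nonneg (a : ℝ) (k : ℕ) (ω : Ω) : 0 ≤ blockMax μ X a k ω :=
  (abs_nonneg _).trans (le_blockMax a le_rfl Nat.one_le_two_pow ω)

lemma blockMax_le [IsProbabilityMeasure μ] {a : ℝ} (ha : 0 < a) (k : ℕ) (ω : Ω) :
    blockMax μ X a k ω ≤ 2 ^ k * (2 * a) := by
  refine Finset.sup'_le _ _ fun l hl => (Finset.abs_sum_le_sum_abs _ _).trans ?_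
  have hE : ∀ i, |∫ ω', trunc a (X i ω') ∂μ| ≤ a := fun i => by
    have := norm_integral_le_of_norm_le_const (μ := μ) (f := fun ω' => trunc a (X i ω'))
      (.of_forall fun ω' => abs_trunc_le ha _)
    simpa using this
  refine (Finset.sum_le_card_nsmul _ _ (2 * a) fun i _ => ?_).trans ?_
  · exact (abs_sub _ _).trans (by linarith [hE i, abs_trunc_le ha (X i ω)])
  · rw [nsmul_eq_mul, Nat.card_Icc, Nat.add_right_comm, Nat.add_sub_cancel_left]
    gcongr
    rw [Finset.mem_Icc] at hl
    exact_mod_cast hl.2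

lemma aestronglyMeasurable_blockMax (hX : ∀ i, 1 ≤ i → AEStronglyMeasurable (X i) μ) {a : ℝ}
    (ha : 0 < a) (k : ℕ) : AEStronglyMeasurable (blockMax μ X a k) μ := by
  have e : blockMax μ X a k = (Finset.Icc 1 (2 ^ k)).sup'
      (Finset.nonempty_Icc.mpr Nat.one_le_two_pow) (fun l ω =>
        |∑ i ∈ Finset.Icc (2 ^ k - 1 + 1) (2 ^ k - 1 + l),
          (trunc a (X i ω) - ∫ ω', trunc a (X i ω') ∂μ)|) := by
    ext ω; rw [Finset.sup'_apply]; rfl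
  rw [e]
  refine Finset.sup'_induction (p := fun f => AEStronglyMeasurable f μ) _ _
    (fun _ hf _ hg => hf.sup hg) fun l _ => ?_
  refine AEStronglyMeasurable.norm (f := fun ω => ∑ i ∈ Finset.Icc (2 ^ k - 1 + 1) (2 ^ k - 1 + l),
    (trunc a (X i ω) - ∫ ω', trunc a (X i ω') ∂μ))
    (Finset.aestronglyMeasurable_fun_sum _ fun i hi => ?_)
  rw [Finset.mem_Icc] at hi
  exact ((continuous_trunc ha).comp_aestronglyMeasurable (hX i (by omega))).sub
    aestronglyMeasurable_const

lemma integrable_blockMax_sq [IsProbabilityMeasure μ]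
    (hX : ∀ i, 1 ≤ i → AEStronglyMeasurable (X i) μ) {a : ℝ}
    (ha : 0 < a) (k : ℕ) : Integrable (fun ω => blockMax μ X a k ω ^ 2) μ := by
  refine .of_bound ((aestronglyMeasurable_blockMax hX ha k).pow 2) ((2 ^ k * (2 * a)) ^ 2)
    (.of_forall fun ω => ?_)
  rw [Real.norm_eq_abs, abs_of_nonneg (sq_nonneg _)]
  exact pow_le_pow_left₀ (blockMax_nonneg _ _ _) (blockMax_le ha k ω) 2

lemma ae_tendsto_blockMax_div [IsProbabilityMeasure μ]
    (h : IsBlockNorming (cesaroTail μ X) b k₀ q K)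
    (hX : ∀ i, 1 ≤ i → AEStronglyMeasurable (X i) μ) (hH : ConditionH μ X) :
    ∀ᵐ ω ∂μ, Tendsto (fun k => blockMax μ X (b k) k ω / b k) atTop (𝓝 0) := by
  obtain ⟨C, hC⟩ := hH
  have hs : Summable fun k => ∫ ω, (blockMax μ X (b (k + k₀)) (k + k₀) ω / b (k + k₀)) ^ 2 ∂μ := by
    have h1 := ((summable_nat_add_iff k₀).mpr (h.summable_variance (cesaroTail_nonneg μ X)
      (b k₀ ^ 2) (sq_nonneg _))).mul_left (2 * |C|)
    refine h1.of_nonneg_of_le (fun k => integral_nonneg fun ω => sq_nonneg _) fun k => ?_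
    have hk : k₀ ≤ k + k₀ := by omega
    generalize k + k₀ = m at *
    have hp := h.pos m hk
    have h2 : ∫ ω, blockMax μ X (b m) m ω ^ 2 ∂μ ≤ C * ∑ i ∈ Finset.Icc (2 ^ m - 1 + 1)
        (2 ^ m - 1 + 2 ^ m), ∫ ω, (trunc (b m) (X i ω)) ^ 2 ∂μ :=
      -- Level and segment length both change with the block, so `C` must be uniform in both.
      hC _ (b m) hp (2 ^ m - 1) (2 ^ m) Nat.one_le_two_pow le_rfl
    have h3 := sum_block_integral_trunc_sq_le h hX hk
    have h4 : 0 ≤ ∑ i ∈ Finset.Icc (2 ^ m - 1 + 1) (2 ^ m - 1 + 2 ^ m),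
        ∫ ω, (trunc (b m) (X i ω)) ^ 2 ∂μ :=
      Finset.sum_nonneg fun i _ => integral_nonneg fun ω => sq_nonneg _
    simp_rw [div_pow]
    rw [integral_div, div_le_iff₀ (by positivity)]
    calc _ ≤ |C| * (2 ^ (m + 1) * (b k₀ ^ 2 +
          ∑ j ∈ Finset.Ico k₀ m, b (j + 1) ^ 2 * cesaroTail μ X (b j))) :=
          h2.trans ((mul_le_mul_of_nonneg_right (le_abs_self C) h4).trans (by gcongr))
      _ = _ := by field_simp; ring
  have := ae_tendsto_zero_of_summable_integral (fun k => ?_) (fun k ω => sq_nonneg _) hs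
  · filter_upwards [this] with ω hω
    rw [← tendsto_add_atTop_iff_nat k₀]
    have := hω.sqrt
    rw [Real.sqrt_zero] at this
    refine this.congr fun k => Real.sqrt_sq ?_
    exact div_nonneg (blockMax_nonneg _ _ _) (h.pos _ (by omega)).le
  · simp_rw [div_pow]
    exact (integrable_blockMax_sq hX (h.pos _ (by omega)) _).div_const _

/-- As `X i` is centred, its truncated mean is minus the mean of the excess, which is split over the
levels `b (k + j)`. Summed over the block, level `j` costs at most `b (k + j + 1) * 2 ^ (k + 1) * G
(b (k + j))`, and `b (k + j) ≤ K * 2 ^ j * b k`. The 8 is 4 from `succ_le` times 2 from `2 ^ (k +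
1)`. -/
lemma sum_block_abs_integral_trunc_le [IsProbabilityMeasure μ]
    (h : IsBlockNorming (cesaroTail μ X) b k₀ q K)
    (hint : ∀ i, 1 ≤ i → Integrable (X i) μ) (hmean : ∀ i, 1 ≤ i → ∫ ω, X i ω ∂μ = 0)
    {k : ℕ} (hk : k₀ ≤ k) :
    ∑ i ∈ Finset.Icc (2 ^ k - 1 + 1) (2 ^ k - 1 + 2 ^ k), |∫ ω, trunc (b k) (X i ω) ∂μ| ≤
      8 * K * b k * ∑' j, 2 ^ (j + k) * cesaroTail μ X (b (j + k)) := by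
  have hp := h.pos k hk
  have hG := cesaroTail_nonneg μ X
  have hsum := (summable_nat_add_iff k).mpr h.summable
  have hK := h.K_nonneg
  have hterm : ∀ i, 1 ≤ i → ENNReal.ofReal |∫ ω, trunc (b k) (X i ω) ∂μ| ≤
      ∑' j, ENNReal.ofReal (b (k + j + 1) * μ.real {ω | b (k + j) < |X i ω|}) := by
    intro i hi
    have hm := (hint i hi).aestronglyMeasurable
    have ht := integrable_trunc hm hp
    have hn : ∀ j, NullMeasurableSet {ω | b (k + j) < |X i ω|} μ := fun j =>
      nullMeasurableSet_lt_abs hm _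
    have e1 : |∫ ω, trunc (b k) (X i ω) ∂μ| ≤ ∫ ω, |X i ω - trunc (b k) (X i ω)| ∂μ := by
      refine le_trans (le_of_eq ?_) abs_integral_le_integral_abs
      rw [integral_sub (hint i hi) ht, hmean i hi, zero_sub, abs_neg]
    calc _ ≤ ENNReal.ofReal (∫ ω, |X i ω - trunc (b k) (X i ω)| ∂μ) := ENNReal.ofReal_le_ofReal e1
      _ = ∫⁻ ω, ENNReal.ofReal |X i ω - trunc (b k) (X i ω)| ∂μ :=
        ofReal_integral_eq_lintegral_ofReal ((hint i hi).sub ht).abs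
          (.of_forall fun _ => abs_nonneg _)
      _ ≤ ∫⁻ ω, ∑' j, ENNReal.ofReal (b (k + j + 1)) *
          {ω | b (k + j) < |X i ω|}.indicator (fun _ => 1) ω ∂μ :=
        lintegral_mono fun ω => h.ofReal_abs_sub_trunc_le (X i ω) hk
      _ = ∑' j, ENNReal.ofReal (b (k + j + 1)) * μ {ω | b (k + j) < |X i ω|} := by
        rw [lintegral_tsum fun j => ((aemeasurable_const (b := (1 : ENNReal))).indicator₀
          (hn j)).const_mul _]
        refine tsum_congr fun j => ?_
        rw [lintegral_const_mul' _ _ ENNReal.ofReal_ne_top, lintegral_indicator_const₀ (hn j),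
          one_mul]
      _ = _ := by
        refine tsum_congr fun j => ?_
        rw [ENNReal.ofReal_mul (h.pos _ (by omega)).le, ofReal_measureReal]
  have hnn : ∀ j, 0 ≤ 2 ^ (j + k) * cesaroTail μ X (b (j + k)) := fun j =>
    mul_nonneg (by positivity) (hG _)
  rw [← ENNReal.ofReal_le_ofReal_iff
    (mul_nonneg (by positivity) (tsum_nonneg hnn)),
    ENNReal.ofReal_sum_of_nonneg fun _ _ => abs_nonneg _, ← tsum_mul_left,
    ENNReal.ofReal_tsum_of_nonneg (fun j => mul_nonneg (by positivity) (hnn j))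
      (hsum.mul_left _)]
  refine (Finset.sum_le_sum fun i hi => hterm i (by rw [Finset.mem_Icc] at hi; omega)).trans ?_
  rw [← Summable.tsum_finsetSum fun i _ => ENNReal.summable]
  refine ENNReal.tsum_le_tsum fun j => ?_
  have hb' := (h.pos (k + j + 1) (by omega)).le
  rw [← ENNReal.ofReal_sum_of_nonneg fun _ _ => mul_nonneg hb' measureReal_nonneg,
    ← Finset.mul_sum]
  refine ENNReal.ofReal_le_ofReal ?_
  have e2 := h.succ_le (k + j) (by omega)
  have e3 := h.almost_antitone k hk (k + j) (by omega)
  rw [div_le_iff₀ (by positivity)] at e3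
  rw [add_comm j k]
  calc _ ≤ b (k + j + 1) * (2 ^ (k + 1) * cesaroTail μ X (b (k + j))) := by
        gcongr; exact sum_block_measureReal_le _ _
    _ ≤ 4 * (K * (b k / 2 ^ k) * 2 ^ (k + j)) * (2 ^ (k + 1) * cesaroTail μ X (b (k + j))) := by
        have := hG (b (k + j))
        gcongr
        linarith
    _ = _ := by field_simp; ring

/-- The strong law along a dyadic norming sequence. -/
lemma ae_tendsto_sum_div_log [IsProbabilityMeasure μ] (h : IsBlockNorming (cesaroTail μ X) b k₀ q K)
    (hint : ∀ i, 1 ≤ i → Integrable (X i) μ) (hmean : ∀ i, 1 ≤ i → ∫ ω, X i ω ∂μ = 0)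
    (hH : ConditionH μ X) :
    ∀ᵐ ω ∂μ, Tendsto (fun n : ℕ => (∑ i ∈ Finset.Icc 1 n, X i ω) / b (Nat.log 2 n))
      atTop (𝓝 0) := by
  filter_upwards [ae_eventually_abs_le h, ae_tendsto_blockMax_div h
    (fun i hi => (hint i hi).aestronglyMeasurable) hH] with ω h1 h2
  -- The block error is the normed maximum plus a tail of a convergent series.
  have h3 := (tendsto_sum_nat_add fun k => 2 ^ k * cesaroTail μ X (b k)).const_mul (8 * K)
  refine tendsto_sum_div_of_block h (by simpa using h2.add h3) ?_
  filter_upwards [h1, eventually_ge_atTop k₀] with k hk hk0 l hl hlk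
  have hp := h.pos k hk0
  have hsub : Finset.Icc (2 ^ k - 1 + 1) (2 ^ k - 1 + l) ⊆
      Finset.Icc (2 ^ k - 1 + 1) (2 ^ k - 1 + 2 ^ k) := Finset.Icc_subset_Icc_right (by omega)
  have e : ∑ i ∈ Finset.Icc (2 ^ k - 1 + 1) (2 ^ k - 1 + l), X i ω =
      ∑ i ∈ Finset.Icc (2 ^ k - 1 + 1) (2 ^ k - 1 + l),
        (trunc (b k) (X i ω) - ∫ ω', trunc (b k) (X i ω') ∂μ) +
      ∑ i ∈ Finset.Icc (2 ^ k - 1 + 1) (2 ^ k - 1 + l), ∫ ω', trunc (b k) (X i ω') ∂μ := by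
    rw [← Finset.sum_add_distrib]
    refine Finset.sum_congr rfl fun i hi => ?_
    rw [sub_add_cancel, trunc_of_abs_le hp (hk i (hsub hi))]
  rw [e, add_mul, div_mul_cancel₀ _ hp.ne']
  refine (abs_add_le _ _).trans (add_le_add (le_blockMax _ hl hlk ω) ?_)
  calc _ ≤ ∑ i ∈ Finset.Icc (2 ^ k - 1 + 1) (2 ^ k - 1 + l), |∫ ω', trunc (b k) (X i ω') ∂μ| :=
        Finset.abs_sum_le_sum_abs _ _
    _ ≤ ∑ i ∈ Finset.Icc (2 ^ k - 1 + 1) (2 ^ k - 1 + 2 ^ k), |∫ ω', trunc (b k) (X i ω') ∂μ| :=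
        Finset.sum_le_sum_of_subset_of_nonneg hsub fun _ _ _ => abs_nonneg _
    _ ≤ _ := sum_block_abs_integral_trunc_le h hint hmean hk0
    _ = _ := by ring

end Block

end MZLaw

end

/-! ### Replacing the dyadic norming by the norming at `n` -/

theorem mainTheorem4 {Ω : Type*} [MeasurableSpace Ω] (μ : Measure Ω) [IsProbabilityMeasure μ]
    (X : ℕ → Ω → ℝ)
    (hint : ∀ i, 1 ≤ i → Integrable (X i) μ)
    (hmean : ∀ i, 1 ≤ i → ∫ ω, X i ω ∂μ = 0)
    (hH : MZLaw.ConditionH μ X)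
    (p : ℝ) (hp1 : 1 ≤ p) (hp2 : p < 2)
    (L Ltilde : ℝ → ℝ)
    (hL : MZLaw.SlowlyVarying L)
    (hLtilde : MZLaw.IsDeBruijnConjugate L Ltilde)
    (hLp : p = 1 → MonotoneOn L (Set.Ici 0) ∧ ∀ x, 0 ≤ x → 1 ≤ L x)
    (hG : IntegrableOn (fun x : ℝ => x ^ (p - 1) * L x ^ p * MZLaw.cesaroTail μ X x)
      (Set.Ioi 0)) :
    ∀ᵐ ω ∂μ, Tendsto
      (fun n : ℕ => (∑ i ∈ Finset.Icc 1 n, X i ω) /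
        ((n : ℝ) ^ (1 / p) * Ltilde ((n : ℝ) ^ (1 / p))))
      atTop (𝓝 0) := by
  obtain ⟨k₀, q, K, h⟩ := MZLaw.exists_isBlockNorming hp1 hp2 hL hLtilde (fun h => (hLp h).1)
    (MZLaw.cesaroTail_nonneg μ X) (MZLaw.cesaroTail_antitone μ X) hG
  filter_upwards [MZLaw.ae_tendsto_sum_div_log h hint hmean hH] with ω hω
  have h2 := hω.norm.const_mul 2
  rw [norm_zero, mul_zero] at h2
  have hlog : Tendsto (Nat.log 2) atTop atTop :=
    tendsto_atTop_atTop.mpr fun k => ⟨2 ^ k, fun n hn => Nat.le_log_of_pow_le one_lt_two hn⟩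
  refine squeeze_zero_norm' ?_ h2
  filter_upwards [MZLaw.eventually_norming_log_le hp1 hLtilde.1,
    hlog.eventually_ge_atTop k₀] with n hn hn0
  have hpos := h.pos _ hn0
  have hpos' : 0 < MZLaw.norming p Ltilde n := by linarith
  change ‖_ / MZLaw.norming p Ltilde n‖ ≤ _
  rw [norm_div, norm_div, Real.norm_of_nonneg hpos.le, Real.norm_of_nonneg hpos'.le,
    mul_div_assoc', div_le_div_iff₀ hpos' hpos]
  nlinarith [norm_nonneg (∑ i ∈ Finset.Icc 1 n, X i ω)]
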